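/- Let $q$ be a prime power and let $k,d,n_1,n_2$ be positive integers with $d$ even, $k\ge d$, $n_1\ge k$ and $n_2\ge k$. For subspaces $U,W\subseteq\mathbb F_q^n$ put $d_S(U,W)=\dim(U+W)-\dim(U\cap W)$, and let $A_q(n,k,d)$ be the largest size of a set of $k$-dimensional subspaces of $\mathbb F_q^n$ any two different members of which satisfy $d_S\ge d$. For $m\ge n\ge\delta\ge 1$ let $Q_q(m,n,\delta)$ denote a linear maximum rank distance code, i.e. an $\mathbb F_q$-linear space of $m\times n$ matrices over $\mathbb F_q$ of size $q^{m(n-\delta+1)}$ in which any two different matrices satisfy $\operatorname{rank}(A-B)\ge\delta$, and let $A_r(Q)$ be the number of matrices of rank $r$ in $Q$. Then codes $Q_q(n_1,k,\tfrac d2)$ and $Q_q(n_2,k,\tfrac d2)$ exist, and for any choice of them $$A_q(n_1+n_2,k,d)\ \ge\ |Q_q(n_1,k,\tfrac d2)|\cdot A_q(n_2,k,d)+A_q(n_1,k,d)\cdot\Bigl(1+\sum_{r=d/2}^{k-d/2}A_r\bigl(Q_q(n_2,k,\tfrac d2)\bigr)\Bigr).$$ Explicitly, the same inequality holds with $|Q_q(n_1,k,\tfrac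 d2)|$ replaced by $q^{n_1(k-d/2+1)}$ and $A_r(Q_q(n_2,k,\tfrac d2))$ replaced by Delsarte's expression $$\binom{k}{r}_q\sum_{i=0}^{r-d/2}(-1)^i q^{\binom i2}\binom{r}{i}_q\Bigl(\frac{q^{n_2(k-d/2+1)}}{q^{n_2(k+i-r)}}-1\Bigr),\qquad \binom{n}{r}_q=\prod_{i=0}^{r-1}\frac{q^{n-i}-1}{q^{r-i}-1}.$$ -/

import Mathlib

namespace CDC

/-- The subspace distance `dim (U + W) - dim (U ∩ W)`. -/
noncomputable def subspaceDist {F : Type*} [Field F] {n : ℕ}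
    (U W : Submodule F (Fin n → F)) : ℕ :=
  Module.finrank F ↥(U ⊔ W) - Module.finrank F ↥(U ⊓ W)

/-- `C` is a constant dimension code in `F ^ n`: a set of `k`-dimensional subspaces, any two
different ones being at subspace distance at least `d`. -/
def IsCDC {F : Type*} [Field F] (n k d : ℕ) (C : Finset (Submodule F (Fin n → F))) : Prop :=
  (∀ U ∈ C, Module.finrank F ↥U = k) ∧
    ∀ U ∈ C, ∀ W ∈ C, U ≠ W → d ≤ subspaceDist U W

/-- `A_q(n, k, d)` for `q = |F|`: the maximal size of a constant dimension code in `F ^ n` with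
codewords of dimension `k` and subspace distance at least `d`. -/
noncomputable def maxCDC (F : Type*) [Field F] (n k d : ℕ) : ℕ :=
  sSup {N : ℕ | ∃ C : Finset (Submodule F (Fin n → F)), IsCDC n k d C ∧ C.card = N}

/-- Over a finite field the supremum defining `maxCDC` is an attained maximum. -/
theorem maxCDC_isGreatest (F : Type*) [Field F] [Fintype F] (n k d : ℕ) :
    IsGreatest {N : ℕ | ∃ C : Finset (Submodule F (Fin n → F)), IsCDC n k d C ∧ C.card = N}
      (maxCDC F n k d) := by
  classical
  haveI : Finite (Submodule F (Fin n → F)) :=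
    Finite.of_injective (fun U => (U : Set (Fin n → F))) SetLike.coe_injective
  haveI := Fintype.ofFinite (Submodule F (Fin n → F))
  have hb : BddAbove
      {N : ℕ | ∃ C : Finset (Submodule F (Fin n → F)), IsCDC n k d C ∧ C.card = N} := by
    refine ⟨Fintype.card (Submodule F (Fin n → F)), ?_⟩
    rintro N ⟨C, -, rfl⟩
    exact Finset.card_le_univ C
  have hne :
      {N : ℕ | ∃ C : Finset (Submodule F (Fin n → F)), IsCDC n k d C ∧ C.card = N}.Nonempty :=
    ⟨0, ∅, by simp [IsCDC], rfl⟩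
  exact ⟨Nat.sSup_mem hne hb, fun N hN => le_csSup hb hN⟩

/-- `Q` is a linear maximum rank distance code of `m × n` matrices over `F` with rank distance
(at least) `δ`, that is, a code `Q_q(m, n, δ)` with `q = |F|`: its size is
`q ^ (max m n * (min m n - δ + 1))`, rounded up to `1` if that exponent is negative. -/
def IsMRD {F : Type*} [Field F] [Fintype F] (m n δ : ℕ)
    (Q : Submodule F (Matrix (Fin m) (Fin n) F)) : Prop :=
  (∀ A ∈ Q, ∀ B ∈ Q, A ≠ B → δ ≤ (A - B).rank) ∧
    Nat.card ↥Q = Fintype.card F ^ (max m n * (min m n + 1 - δ))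

/-- The rank distribution `A_r(Q)`: the number of matrices of rank `r` in `Q`. -/
noncomputable def rankCount {F : Type*} [Field F] {m n : ℕ}
    (Q : Submodule F (Matrix (Fin m) (Fin n) F)) (r : ℕ) : ℕ :=
  {A : Matrix (Fin m) (Fin n) F | A ∈ Q ∧ A.rank = r}.ncard

/-- The `q`-binomial coefficient (for `r > n` the factor with `i = n` makes it zero). -/
def gaussBinom (q n r : ℕ) : ℚ :=
  ∏ i ∈ Finset.range r, ((q : ℚ) ^ (n - i) - 1) / ((q : ℚ) ^ (r - i) - 1)

/-- Delsarte's expression for the number of matrices of rank `r`, where `δ ≤ r ≤ n ≤ m`, in a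
maximum rank distance code of `m × n` matrices with rank distance `δ`. -/
def delsarteCount (q m n δ r : ℕ) : ℚ :=
  gaussBinom q n r * ∑ i ∈ Finset.range (r - δ + 1),
    (-1) ^ i * (q : ℚ) ^ (i.choose 2) * gaussBinom q r i *
      ((q : ℚ) ^ (m * (n - δ + 1)) / (q : ℚ) ^ (m * (n + i - r)) - 1)

end CDC

namespace CDC

open Module

/-! Put d = 2δ. For k-dimensional subspaces, distance at least 2δ means that the intersection has
dimension at most k - δ. Take optimal codes C₁, C₂ in F^n₁, F^n₂ and write each codeword U as the
range of an injection φ_U on F^k. The new code consists of the spaces {(Mx, φ_U x)} with M ∈ Q₁, U ∈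
C₂, and {(φ_U x, Mx)} with U ∈ C₁, M ∈ Q₂, rank M ≤ k - δ. Within a family, projection to the
injective coordinate embeds an intersection into U ∩ U'; if U = U', the intersection comes from ker
(M - M'). Across families, projection to the second factor embeds it into the range of a matrix of
rank at most k - δ. This is `card_mul_maxCDC_add_le`.

The required codes come from linearized polynomials with few coefficients, whose kernels are small
(`exists_isLinearMRD`). For Delsarte's formula, the number of codewords vanishing on a subspace
depends only on its dimension; double counting gives a triangular system for the rank distribution,
solved by `gaussBinom_inversion`. -/

/-! ### Gaussian binomial coefficients. -/

/-- `∏_{i < n} (q ^ (i + 1) - 1)`. -/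
def qFactor (q n : ℕ) : ℚ := ∏ i ∈ Finset.range n, ((q : ℚ) ^ (i + 1) - 1)

theorem qFactor_succ (q n : ℕ) : qFactor q (n + 1) = qFactor q n * ((q : ℚ) ^ (n + 1) - 1) :=
  Finset.prod_range_succ _ _

theorem pow_sub_one_ne_zero {q : ℕ} (hq : 1 < q) {n : ℕ} (hn : n ≠ 0) : (q : ℚ) ^ n - 1 ≠ 0 := by
  have : (1 : ℚ) < (q : ℚ) ^ n := one_lt_pow₀ (by exact_mod_cast hq) hn
  exact sub_ne_zero.mpr this.ne'

theorem qFactor_ne_zero {q : ℕ} (hq : 1 < q) (n : ℕ) : qFactor q n ≠ 0 :=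
  Finset.prod_ne_zero_iff.mpr fun i _ => pow_sub_one_ne_zero hq i.succ_ne_zero

theorem prod_pow_sub_one_mul_qFactor (q : ℕ) {n r : ℕ} (h : r ≤ n) :
    (∏ i ∈ Finset.range r, ((q : ℚ) ^ (n - i) - 1)) * qFactor q (n - r) = qFactor q n := by
  induction r with
  | zero => simp
  | succ r ih =>
    rw [← ih (by omega), Finset.prod_range_succ, show n - r = n - (r + 1) + 1 by omega,
      qFactor_succ]
    ring

theorem gaussBinom_eq_qFactor {q : ℕ} (hq : 1 < q) {n r : ℕ} (h : r ≤ n) :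
    gaussBinom q n r = qFactor q n / (qFactor q r * qFactor q (n - r)) := by
  have h1 := prod_pow_sub_one_mul_qFactor q h
  have h2 := prod_pow_sub_one_mul_qFactor q (le_refl r)
  have h0 : qFactor q (r - r) = 1 := by simp [qFactor]
  rw [h0, mul_one] at h2
  rw [gaussBinom, Finset.prod_div_distrib, h2, ← h1]
  have := qFactor_ne_zero hq (n - r)
  have := qFactor_ne_zero hq r
  field_simp

theorem gaussBinom_eq_zero (q : ℕ) {n r : ℕ} (h : n < r) : gaussBinom q n r = 0 :=
  Finset.prod_eq_zero (Finset.mem_range.mpr h) (by simp)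

theorem gaussBinom_zero_right (q n : ℕ) : gaussBinom q n 0 = 1 := by simp [gaussBinom]

theorem gaussBinom_self {q : ℕ} (hq : 1 < q) (n : ℕ) : gaussBinom q n n = 1 := by
  rw [gaussBinom_eq_qFactor hq le_rfl, Nat.sub_self]
  have := qFactor_ne_zero hq n
  rw [show qFactor q 0 = 1 from Finset.prod_range_zero _, mul_one, div_self this]

theorem gaussBinom_symm {q : ℕ} (hq : 1 < q) {n r : ℕ} (h : r ≤ n) :
    gaussBinom q n (n - r) = gaussBinom q n r := by
  rw [gaussBinom_eq_qFactor hq h, gaussBinom_eq_qFactor hq (Nat.sub_le n r), Nat.sub_sub_self h,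
    mul_comm]

theorem gaussBinom_succ_succ {q : ℕ} (hq : 1 < q) (n r : ℕ) :
    gaussBinom q (n + 1) (r + 1) =
      (q : ℚ) ^ (r + 1) * gaussBinom q n (r + 1) + gaussBinom q n r := by
  rcases lt_trichotomy n r with h | rfl | h
  · rw [gaussBinom_eq_zero q (by omega), gaussBinom_eq_zero q (by omega),
      gaussBinom_eq_zero q h]
    ring
  · rw [gaussBinom_self hq, gaussBinom_self hq, gaussBinom_eq_zero q (by omega)]
    ring
  · obtain ⟨t, rfl⟩ : ∃ t, n = r + t + 1 := ⟨n - r - 1, by omega⟩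
    rw [gaussBinom_eq_qFactor hq (by omega), gaussBinom_eq_qFactor hq (by omega),
      gaussBinom_eq_qFactor hq (by omega), show r + t + 1 + 1 - (r + 1) = t + 1 by omega,
      show r + t + 1 - (r + 1) = t by omega, show r + t + 1 - r = t + 1 by omega,
      qFactor_succ q (r + t + 1), qFactor_succ q r, qFactor_succ q t]
    have := qFactor_ne_zero hq r
    have := qFactor_ne_zero hq t
    have := pow_sub_one_ne_zero hq r.succ_ne_zero
    have := pow_sub_one_ne_zero hq t.succ_ne_zero
    simp only [Nat.succ_eq_add_one] at *
    field_simp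
    ring

/-- By the q-Pascal rule the partial sums telescope to a single term, which vanishes at the end of
the range. -/
theorem alternating_sum_gaussBinom {q : ℕ} (hq : 1 < q) {n : ℕ} (hn : n ≠ 0) :
    ∑ i ∈ Finset.range (n + 1),
      (-1) ^ i * (q : ℚ) ^ (i.choose 2) * gaussBinom q n i = 0 := by
  obtain ⟨n, rfl⟩ := Nat.exists_eq_succ_of_ne_zero hn
  have key : ∀ j, ∑ i ∈ Finset.range (j + 1),
      (-1) ^ i * (q : ℚ) ^ (i.choose 2) * gaussBinom q (n + 1) i =
        (-1) ^ j * (q : ℚ) ^ ((j + 1).choose 2) * gaussBinom q n j := by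
    intro j
    induction j with
    | zero => simp [gaussBinom_zero_right]
    | succ j ih =>
      rw [Finset.sum_range_succ, ih, gaussBinom_succ_succ hq, Nat.choose_succ_succ' (j + 1) 1,
        Nat.choose_one_right]
      ring
  rw [Nat.succ_eq_add_one, key, gaussBinom_eq_zero q (Nat.lt_succ_self n), mul_zero]

/-- Both sides are the q-multinomial coefficient of n = b + (a - b) + (n - a). -/
theorem gaussBinom_mul_gaussBinom {q : ℕ} (hq : 1 < q) {n a b : ℕ} (hb : b ≤ a) (ha : a ≤ n) :
    gaussBinom q n a * gaussBinom q a b = gaussBinom q n b * gaussBinom q (n - b) (n - a) := by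
  rw [gaussBinom_eq_qFactor hq ha, gaussBinom_eq_qFactor hq hb,
    gaussBinom_eq_qFactor hq (hb.trans ha), gaussBinom_eq_qFactor hq (by omega),
    show n - b - (n - a) = a - b by omega]
  have := qFactor_ne_zero hq a
  have := qFactor_ne_zero hq b
  have := qFactor_ne_zero hq (n - a)
  have := qFactor_ne_zero hq (n - b)
  have := qFactor_ne_zero hq (a - b)
  field_simp

/-- Inversion of a triangular system with Gaussian binomial coefficients. -/
theorem gaussBinom_inversion {q : ℕ} (hq : 1 < q) {k r : ℕ} (hr : r ≤ k) (N : ℕ → ℚ) :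
    ∑ i ∈ Finset.range (r + 1), (-1) ^ i * (q : ℚ) ^ (i.choose 2) *
      gaussBinom q (k - (r - i)) (k - r) *
        ∑ t ∈ Finset.range (k + 1), gaussBinom q (k - t) (k - (r - i)) * N t = N r := by
  simp_rw [Finset.mul_sum]
  -- After the exchange, the coefficient of `N t` must be 1 for t = r and 0 otherwise. For t < r it
  -- is a multiple of the alternating sum of length r - t; for t > r every summand is zero.
  rw [Finset.sum_comm, Finset.sum_eq_single r]
  · rw [Finset.sum_eq_single 0]
    · simp [gaussBinom_self hq]
    · intro i hi hi0
      rw [Finset.mem_range] at hi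
      rw [gaussBinom_eq_zero q (show k - r < k - (r - i) by omega)]
      ring
    · simp
  · intro t ht htr
    rw [Finset.mem_range] at ht
    rcases lt_or_gt_of_ne htr with h | h
    · have h0 := alternating_sum_gaussBinom hq (show r - t ≠ 0 by omega)
      have : ∀ i ∈ Finset.range (r + 1), (-1) ^ i * (q : ℚ) ^ (i.choose 2) *
          gaussBinom q (k - (r - i)) (k - r) * (gaussBinom q (k - t) (k - (r - i)) * N t) =
          (gaussBinom q (k - t) (k - r) * N t) *
            ((-1) ^ i * (q : ℚ) ^ (i.choose 2) * gaussBinom q (r - t) i) := by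
        intro i hi
        rw [Finset.mem_range] at hi
        by_cases hit : i ≤ r - t
        · have := gaussBinom_mul_gaussBinom hq (n := k - t) (a := k - (r - i)) (b := k - r)
            (by omega) (by omega)
          rw [show k - t - (k - r) = r - t by omega,
            show k - t - (k - (r - i)) = r - t - i by omega, gaussBinom_symm hq hit] at this
          linear_combination ((-1) ^ i * (q : ℚ) ^ (i.choose 2) * N t) * this
        · rw [gaussBinom_eq_zero q (show r - t < i by omega),
            gaussBinom_eq_zero q (show k - t < k - (r - i) by omega)]
          ring
      rw [Finset.sum_congr rfl this, ← Finset.mul_sum,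
        ← Finset.sum_subset (Finset.range_mono (show r - t + 1 ≤ r + 1 by omega)), h0, mul_zero]
      intro i _ hi
      rw [Finset.mem_range] at hi
      rw [gaussBinom_eq_zero q (show r - t < i by omega), mul_zero]
    · refine Finset.sum_eq_zero fun i hi => ?_
      rw [gaussBinom_eq_zero q (show k - t < k - (r - i) by omega)]
      ring
  · intro h
    exact absurd (Finset.mem_range.mpr (by omega)) h

/-! ### Counting subspaces. -/

theorem exists_submodule_finrank_eq {F V : Type*} [Field F] [AddCommGroup V] [Module F V]
    [FiniteDimensional F V] (K : Submodule F V) {j : ℕ} (h1 : finrank F K ≤ j)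
    (h2 : j ≤ finrank F V) : ∃ K' : Submodule F V, K ≤ K' ∧ finrank F K' = j := by
  obtain ⟨C, hC⟩ := K.exists_isCompl
  have hdim := Submodule.finrank_add_eq_of_isCompl hC
  obtain ⟨f, hf⟩ := (finrank_le_iff_exists_linearMap
    (R := F) (M := Fin (j - finrank F K) → F) (M' := C)).mp (by simp; omega)
  refine ⟨K ⊔ f.range.map C.subtype, le_sup_left, ?_⟩
  have hfr : finrank F (f.range.map C.subtype) = j - finrank F K := by
    rw [LinearEquiv.finrank_eq (Submodule.equivMapOfInjective _ C.injective_subtype _).symm,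
      LinearMap.finrank_range_of_inj hf, finrank_fin_fun]
  have hinf : K ⊓ f.range.map C.subtype = ⊥ := by
    rw [eq_bot_iff, ← hC.inf_eq_bot]
    exact inf_le_inf_left _ (Submodule.map_subtype_le _ _)
  have := Submodule.finrank_sup_add_finrank_inf_eq K (f.range.map C.subtype)
  rw [hinf, hfr, finrank_bot] at this
  omega

theorem prod_pow_sub_pow (q : ℚ) {n j : ℕ} (hj : j ≤ n) :
    ∏ i ∈ Finset.range j, (q ^ n - q ^ i) =
      (∏ i ∈ Finset.range j, q ^ i) * ∏ i ∈ Finset.range j, (q ^ (n - i) - 1) := by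
  rw [← Finset.prod_mul_distrib]
  refine Finset.prod_congr rfl fun i hi => ?_
  rw [Finset.mem_range] at hi
  rw [mul_sub, ← pow_add, Nat.add_sub_cancel' (by omega), mul_one]

theorem card_linearIndependent_cast {F V : Type*} [Field F] [Fintype F] [AddCommGroup V]
    [Module F V] [Finite V] {j : ℕ} (hj : j ≤ finrank F V) :
    (Nat.card {s : Fin j → V // LinearIndependent F s} : ℚ) =
      (∏ i ∈ Finset.range j, (Fintype.card F : ℚ) ^ i) *
        ∏ i ∈ Finset.range j, ((Fintype.card F : ℚ) ^ (finrank F V - i) - 1) := by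
  rw [card_linearIndependent hj, ← prod_pow_sub_pow _ hj, Finset.prod_range, Nat.cast_prod]
  refine Finset.prod_congr rfl fun i _ => ?_
  rw [Nat.cast_sub (Nat.pow_le_pow_right Fintype.card_pos (by omega))]
  push_cast
  rfl

/-- The linearly independent families in `V` that come from a `j`-dimensional subspace. -/
def familyOfSubmodule (F V : Type*) [Field F] [AddCommGroup V] [Module F V] (j : ℕ)
    (t : Σ K : {K : Submodule F V // finrank F K = j},
      {s : Fin j → K.1 // LinearIndependent F s}) : {s : Fin j → V // LinearIndependent F s} :=
  ⟨fun i => t.2.1 i, t.2.2.map' _ (Submodule.ker_subtype _)⟩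

theorem span_familyOfSubmodule {F V : Type*} [Field F] [AddCommGroup V] [Module F V]
    [FiniteDimensional F V] {j : ℕ} (t : Σ K : {K : Submodule F V // finrank F K = j},
      {s : Fin j → K.1 // LinearIndependent F s}) :
    Submodule.span F (Set.range (familyOfSubmodule F V j t).1) = t.1.1 := by
  refine Submodule.eq_of_le_of_finrank_eq ?_ ?_
  · rw [Submodule.span_le]
    rintro _ ⟨i, rfl⟩
    exact (t.2.1 i).2
  · rw [finrank_span_eq_card (familyOfSubmodule F V j t).2, Fintype.card_fin, t.1.2]

/-- Independent j-tuples of V are partitioned by their span, so the number of j-dimensional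
subspaces is a quotient of two counts of tuples. -/
theorem familyOfSubmodule_bijective (F V : Type*) [Field F] [AddCommGroup V] [Module F V]
    [FiniteDimensional F V] (j : ℕ) : Function.Bijective (familyOfSubmodule F V j) := by
  constructor
  · intro t t' h
    have hK : t.1.1 = t'.1.1 := by rw [← span_familyOfSubmodule t, h, span_familyOfSubmodule]
    obtain ⟨⟨K, _⟩, s⟩ := t
    obtain ⟨⟨K', _⟩, s'⟩ := t'
    obtain rfl : K = K' := hK
    congr 1
    ext i
    exact congrFun (congrArg Subtype.val h) i
  · intro s
    exact ⟨⟨⟨Submodule.span F (Set.range s.1), by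
        rw [finrank_span_eq_card s.2, Fintype.card_fin]⟩,
      ⟨fun i => ⟨s.1 i, Submodule.subset_span ⟨i, rfl⟩⟩,
        LinearIndependent.of_comp (Submodule.subtype _) s.2⟩⟩, rfl⟩

/-- The number of `j`-dimensional subspaces is a Gaussian binomial coefficient. -/
theorem card_submodule_finrank_eq {F V : Type*} [Field F] [Fintype F] [AddCommGroup V]
    [Module F V] [Finite V] (j : ℕ) :
    (Nat.card {K : Submodule F V // finrank F K = j} : ℚ) =
      gaussBinom (Fintype.card F) (finrank F V) j := by
  have hq : 1 < Fintype.card F := Fintype.one_lt_card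
  rcases lt_or_ge (finrank F V) j with h | h
  · rw [gaussBinom_eq_zero _ h]
    have : IsEmpty {K : Submodule F V // finrank F K = j} :=
      ⟨fun K => by have := K.1.finrank_le; have := K.2; omega⟩
    simp
  · have : Finite (Submodule F V) := Finite.of_injective _ SetLike.coe_injective
    have := Fintype.ofFinite {K : Submodule F V // finrank F K = j}
    have hc := congrArg (Nat.cast (R := ℚ)) 
      (Nat.card_congr (Equiv.ofBijective _ (familyOfSubmodule_bijective F V j)).symm)
    rw [Nat.card_sigma, card_linearIndependent_cast h, Nat.cast_sum,
      Finset.sum_congr rfl fun K _ => card_linearIndependent_cast K.2.ge] at hc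
    simp_rw [fun K : {K : Submodule F V // finrank F K = j} => K.2] at hc
    rw [Finset.sum_const, nsmul_eq_mul, Finset.card_univ,
      ← Nat.card_eq_fintype_card (α := {K : Submodule F V // finrank F K = j})] at hc
    have h0 : ∏ i ∈ Finset.range j, (Fintype.card F : ℚ) ^ i ≠ 0 :=
      Finset.prod_ne_zero_iff.mpr fun i _ => pow_ne_zero _ (by positivity)
    have h1 : ∏ i ∈ Finset.range j, ((Fintype.card F : ℚ) ^ (j - i) - 1) ≠ 0 :=
      Finset.prod_ne_zero_iff.mpr fun i hi =>
        pow_sub_one_ne_zero hq (by rw [Finset.mem_range] at hi; omega)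
    rw [gaussBinom, Finset.prod_div_distrib, eq_div_iff h1]
    apply mul_left_cancel₀ h0
    rw [hc]
    ring

theorem card_submodule_le_finrank_eq {F V : Type*} [Field F] [Fintype F] [AddCommGroup V]
    [Module F V] [Finite V] (U : Submodule F V) (j : ℕ) :
    (Nat.card {K : Submodule F V // finrank F K = j ∧ K ≤ U} : ℚ) =
      gaussBinom (Fintype.card F) (finrank F U) j := by
  rw [← card_submodule_finrank_eq (V := U)]
  congr 1
  refine Nat.card_congr
    { toFun := fun K => ⟨K.1.comap U.subtype, ?_⟩
      invFun := fun K => ⟨K.1.map U.subtype, ?_, Submodule.map_subtype_le _ _⟩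
      left_inv := fun K => Subtype.ext ?_
      right_inv := fun K => Subtype.ext ?_ }
  · rw [(Submodule.comapSubtypeEquivOfLe K.2.2).finrank_eq, K.2.1]
  · rw [← (Submodule.equivMapOfInjective _ U.injective_subtype _).finrank_eq, K.2]
  · simpa using K.2.2
  · exact Submodule.comap_map_eq_of_injective U.injective_subtype _

/-! ### Rank distribution of linear maximum rank distance codes. -/

/-- A linear maximum rank distance code, as a space of linear maps `V → W`. -/
structure IsLinearMRD {F V W : Type*} [Field F] [AddCommGroup V] [Module F V] [AddCommGroup W]
    [Module F W] (δ : ℕ) (Q : Submodule F (V →ₗ[F] W)) : Prop where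
  le_rank : ∀ f ∈ Q, f ≠ 0 → δ ≤ finrank F f.range
  finrank_eq : finrank F Q = finrank F W * (finrank F V + 1 - δ)

/-- Restriction of the members of `Q` to the subspace `K`. -/
def restrictTo {F V W : Type*} [Field F] [AddCommGroup V] [Module F V] [AddCommGroup W]
    [Module F W] (Q : Submodule F (V →ₗ[F] W)) (K : Submodule F V) : Q →ₗ[F] K →ₗ[F] W :=
  LinearMap.lcomp F W K.subtype ∘ₗ Q.subtype

section

variable {F V W : Type*} [Field F] [AddCommGroup V] [Module F V] [AddCommGroup W]
  [Module F W] {δ : ℕ} {Q : Submodule F (V →ₗ[F] W)}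

theorem mem_ker_restrictTo {K : Submodule F V} {f : Q} :
    f ∈ (restrictTo Q K).ker ↔ K ≤ f.1.ker := by
  rw [LinearMap.mem_ker, LinearMap.ext_iff]
  exact ⟨fun h x hx => h ⟨x, hx⟩, fun h x => h x.2⟩

variable [FiniteDimensional F V]

/-- A map vanishing on K has rank at most dim V - dim K < δ. -/
theorem IsLinearMRD.ker_restrictTo_eq_bot (hQ : IsLinearMRD δ Q) {K : Submodule F V}
    (hK : finrank F V < finrank F K + δ) : (restrictTo Q K).ker = ⊥ := by
  rw [eq_bot_iff]
  intro f hf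
  by_contra hne
  have h1 := hQ.le_rank f.1 f.2 fun h => hne (by simpa using h)
  have h2 := Submodule.finrank_mono (mem_ker_restrictTo.mp hf)
  have h3 := f.1.finrank_range_add_finrank_ker
  omega

variable [FiniteDimensional F W]

/-- In the critical dimension dim V + 1 - δ, restriction is injective between spaces of equal
dimension, hence onto. A smaller K lies in such a K', so restriction to K is onto as well, and
rank-nullity gives the kernel. For s < δ the truncated exponent is 0. -/
theorem IsLinearMRD.finrank_ker_restrictTo (hQ : IsLinearMRD δ Q) (hδ : 1 ≤ δ)
    (hδk : δ ≤ finrank F V) {K : Submodule F V} {s : ℕ} (hs : s ≤ finrank F V)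
    (hK : finrank F K = finrank F V - s) :
    finrank F (restrictTo Q K).ker = finrank F W * (s + 1 - δ) := by
  rcases lt_or_ge s δ with h | h
  · rw [hQ.ker_restrictTo_eq_bot (by omega), finrank_bot, show s + 1 - δ = 0 by omega, mul_zero]
  · obtain ⟨K', hKK', hK'⟩ := exists_submodule_finrank_eq K (j := finrank F V + 1 - δ)
      (by omega) (by omega)
    have hsurj' : Function.Surjective (restrictTo Q K') := by
      refine (LinearMap.injective_iff_surjective_of_finrank_eq_finrank ?_).mp
        (LinearMap.ker_eq_bot.mp (hQ.ker_restrictTo_eq_bot (by omega)))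
      rw [hQ.finrank_eq, finrank_linearMap, hK', mul_comm]
    have hsurj : Function.Surjective (restrictTo Q K) := by
      intro g
      obtain ⟨g', hg'⟩ := LinearMap.exists_extend g
      obtain ⟨f, hf⟩ := hsurj' (g' ∘ₗ K'.subtype)
      refine ⟨f, ?_⟩
      rw [← hg']
      ext x
      exact LinearMap.congr_fun hf ⟨x, hKK' x.2⟩
    have := (restrictTo Q K).finrank_range_add_finrank_ker
    rw [LinearMap.range_eq_top.mpr hsurj, finrank_top, finrank_linearMap, hQ.finrank_eq, hK,
      mul_comm, show finrank F V + 1 - δ = (finrank F V - s) + (s + 1 - δ) by omega,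
      mul_add] at this
    exact Nat.add_left_cancel this

variable [Fintype F]

open scoped Classical in
-- Double count the pairs (K, f) with K ≤ ker f and dim K = dim V - s: a map of rank t has a kernel
-- of dimension dim V - t.
theorem IsLinearMRD.sum_gaussBinom_mul_card (hQ : IsLinearMRD δ Q) (hδ : 1 ≤ δ)
    (hδk : δ ≤ finrank F V) {s : ℕ} (hs : s ≤ finrank F V) :
    ∑ t ∈ Finset.range (finrank F V + 1),
      gaussBinom (Fintype.card F) (finrank F V - t) (finrank F V - s) *
        (Nat.card {f : Q // finrank F f.1.range = t} : ℚ) =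
      gaussBinom (Fintype.card F) (finrank F V) (finrank F V - s) *
        (Fintype.card F : ℚ) ^ (finrank F W * (s + 1 - δ)) := by
  have : Finite V := Module.finite_of_finite F
  have : Finite W := Module.finite_of_finite F
  have : Finite (Submodule F V) := Finite.of_injective _ SetLike.coe_injective
  have : Finite Q := Module.finite_of_finite F
  have := Fintype.ofFinite (Submodule F V)
  have := Fintype.ofFinite Q
  have key := Finset.sum_card_bipartiteAbove_eq_sum_card_bipartiteBelow
    (fun (K : Submodule F V) (f : Q) => K ≤ f.1.ker)
    (s := Finset.univ.filter fun K => finrank F K = finrank F V - s) (t := Finset.univ)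
  have habove : ∀ K ∈ Finset.univ.filter fun K : Submodule F V => finrank F K = finrank F V - s,
      (Finset.bipartiteAbove (fun (K : Submodule F V) (f : Q) => K ≤ f.1.ker)
        Finset.univ K).card = Fintype.card F ^ (finrank F W * (s + 1 - δ)) := by
    intro K hK
    rw [← hQ.finrank_ker_restrictTo hδ hδk hs (Finset.mem_filter.mp hK).2,
      ← Nat.card_eq_fintype_card (α := F), ← Module.natCard_eq_pow_finrank (V := (restrictTo Q K).ker),
      Finset.bipartiteAbove, ← Fintype.card_subtype,
      ← Nat.card_eq_fintype_card (α := {f : Q // K ≤ f.1.ker})]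
    exact Nat.card_congr (Equiv.subtypeEquivRight fun f => mem_ker_restrictTo.symm)
  have hbelow : ∀ f : Q, ((Finset.bipartiteBelow (fun (K : Submodule F V) (f : Q) => K ≤ f.1.ker)
        (Finset.univ.filter fun K => finrank F K = finrank F V - s) f).card : ℚ) =
      gaussBinom (Fintype.card F) (finrank F V - finrank F f.1.range) (finrank F V - s) := by
    intro f
    have h1 : finrank F V - finrank F f.1.range = finrank F f.1.ker := by
      have := f.1.finrank_range_add_finrank_ker
      omega
    rw [h1, ← card_submodule_le_finrank_eq, Finset.bipartiteBelow, Finset.filter_filter,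
      ← Fintype.card_subtype, ← Nat.card_eq_fintype_card]
  rw [Finset.sum_congr rfl habove, Finset.sum_const, smul_eq_mul] at key
  have key' := congrArg (Nat.cast (R := ℚ)) key
  rw [Nat.cast_sum, Finset.sum_congr rfl fun f _ => hbelow f, Nat.cast_mul,
    ← Fintype.card_subtype, ← Nat.card_eq_fintype_card, card_submodule_finrank_eq,
    Nat.cast_pow] at key'
  rw [key', ← Finset.sum_fiberwise_of_maps_to (s := Finset.univ)
    (t := Finset.range (finrank F V + 1)) (g := fun f : Q => finrank F f.1.range)
    fun f _ => Finset.mem_range.mpr (Nat.lt_succ_of_le f.1.finrank_range_le)]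
  refine Finset.sum_congr rfl fun t _ => ?_
  rw [Finset.sum_congr rfl fun f hf => by rw [(Finset.mem_filter.mp hf).2], Finset.sum_const,
    nsmul_eq_mul, mul_comm, ← Fintype.card_subtype,
    ← Nat.card_eq_fintype_card (α := {f : Q // finrank F f.1.range = t})]

/-- Delsarte's formula for the rank distribution of a linear maximum rank distance code. -/
theorem IsLinearMRD.card_rank_eq (hQ : IsLinearMRD δ Q) (hδ : 1 ≤ δ) {r : ℕ} (hδr : δ ≤ r)
    (hr : r ≤ finrank F V) :
    (Nat.card {f : Q // finrank F f.1.range = r} : ℚ) =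
      delsarteCount (Fintype.card F) (finrank F W) (finrank F V) δ r := by
  have hq : 1 < Fintype.card F := Fintype.one_lt_card
  have hq0 : (Fintype.card F : ℚ) ≠ 0 := by positivity
  set k := finrank F V
  set m := finrank F W
  set q := Fintype.card F
  rw [← gaussBinom_inversion hq hr fun t => (Nat.card {f : Q // finrank F f.1.range = t} : ℚ)]
  -- Split the power as (power - 1) + 1; the part from 1 is an alternating sum, zero since r ≥ δ ≥
  -- 1.
  have hterm : ∀ i ∈ Finset.range (r + 1), (-1) ^ i * (q : ℚ) ^ (i.choose 2) *
      gaussBinom q (k - (r - i)) (k - r) * ∑ t ∈ Finset.range (k + 1),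
        gaussBinom q (k - t) (k - (r - i)) * (Nat.card {f : Q // finrank F f.1.range = t} : ℚ) =
      gaussBinom q k r * ((-1) ^ i * (q : ℚ) ^ (i.choose 2) * gaussBinom q r i *
        ((q : ℚ) ^ (m * (r - i + 1 - δ)) - 1)) +
      gaussBinom q k r * ((-1) ^ i * (q : ℚ) ^ (i.choose 2) * gaussBinom q r i) := by
    intro i hi
    rw [Finset.mem_range] at hi
    rw [hQ.sum_gaussBinom_mul_card hδ (hδr.trans hr) (show r - i ≤ k by omega)]
    have := gaussBinom_mul_gaussBinom hq (n := k) (a := k - (r - i)) (b := k - r)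
      (by omega) (by omega)
    rw [show k - (k - r) = r by omega, show k - (k - (r - i)) = r - i by omega,
      gaussBinom_symm hq hr, gaussBinom_symm hq (show i ≤ r by omega)] at this
    linear_combination ((-1) ^ i * (q : ℚ) ^ (i.choose 2) *
      (q : ℚ) ^ (m * (r - i + 1 - δ))) * this
  rw [Finset.sum_congr rfl hterm, Finset.sum_add_distrib, ← Finset.mul_sum, ← Finset.mul_sum,
    alternating_sum_gaussBinom hq (by omega), mul_zero, add_zero, delsarteCount,
    ← Finset.sum_subset (Finset.range_mono (show r - δ + 1 ≤ r + 1 by omega))]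
  · congr 1
    refine Finset.sum_congr rfl fun i hi => ?_
    rw [Finset.mem_range] at hi
    congr 2
    rw [eq_div_iff (pow_ne_zero _ hq0), ← pow_add, ← mul_add]
    congr 2
    omega
  -- For i > r - δ the truncated exponent is 0, so the factor power - 1 vanishes.
  · intro i _ hi
    rw [Finset.mem_range] at hi
    rw [show r - i + 1 - δ = 0 by omega]
    simp

end

/-! ### Existence of codes from linearized polynomials. -/

/-- The map `x ↦ ∑ i, a i * x ^ (q ^ i)` given by a linearized polynomial. -/
noncomputable def linearizedMap (F : Type*) {L : Type*} [Field F] [Fintype F] [Field L]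
    [Algebra F L] {s : ℕ} (a : Fin s → L) : L →ₗ[F] L :=
  ∑ i, LinearMap.mulLeft F (a i) ∘ₗ (FiniteField.frobeniusAlgHom F L ^ (i : ℕ)).toLinearMap

theorem linearizedMap_apply (F : Type*) {L : Type*} [Field F] [Fintype F] [Field L]
    [Algebra F L] {s : ℕ} (a : Fin s → L) (x : L) :
    linearizedMap F a x = ∑ i, a i * x ^ Fintype.card F ^ (i : ℕ) := by
  rw [linearizedMap, LinearMap.sum_apply]
  refine Finset.sum_congr rfl fun i _ => ?_
  rw [LinearMap.comp_apply, LinearMap.mulLeft_apply, AlgHom.toLinearMap_apply, AlgHom.coe_pow,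
    FiniteField.coe_frobeniusAlgHom, pow_iterate]

/-- The kernel consists of roots of a nonzero polynomial of degree at most q^(s-1). -/
theorem finrank_ker_linearizedMap_lt {F L : Type*} [Field F] [Fintype F] [Field L]
    [Algebra F L] [FiniteDimensional F L] {s : ℕ} {a : Fin s → L} (ha : a ≠ 0) :
    finrank F (linearizedMap F a).ker < s := by
  classical
  have hq : 1 < Fintype.card F := Fintype.one_lt_card
  obtain ⟨i₀, hi₀⟩ := Function.ne_iff.mp ha
  have hs : 0 < s := i₀.pos
  let P : Polynomial L := ∑ i : Fin s, Polynomial.monomial (Fintype.card F ^ (i : ℕ)) (a i)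
  have hP : P ≠ 0 := by
    intro h
    have hc := congrArg (Polynomial.coeff · (Fintype.card F ^ (i₀ : ℕ))) h
    simp only [P, Polynomial.finsetSum_coeff, Polynomial.coeff_monomial,
      Polynomial.coeff_zero] at hc
    rw [Finset.sum_eq_single i₀] at hc
    · exact hi₀ (by simpa using hc)
    · intro j _ hj
      exact if_neg fun h => hj (Fin.ext (Nat.pow_right_injective hq h))
    · simp
  have hdeg : P.natDegree ≤ Fintype.card F ^ (s - 1) :=
    Polynomial.natDegree_sum_le_of_forall_le _ _ fun i _ =>
      (Polynomial.natDegree_monomial_le _).trans (Nat.pow_le_pow_right hq.le (by omega))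
  have : Finite L := Module.finite_of_finite F
  have := Fintype.ofFinite (linearizedMap F a).ker
  have hcard : Fintype.card (linearizedMap F a).ker ≤ P.natDegree := by
    have hsub : (Finset.univ.image fun x : (linearizedMap F a).ker => (x : L)).val ⊆ P.roots := by
      intro x hx
      rw [Finset.mem_val, Finset.mem_image] at hx
      obtain ⟨y, -, rfl⟩ := hx
      rw [Polynomial.mem_roots hP, Polynomial.IsRoot, Polynomial.eval_finsetSum]
      have := y.2
      rw [LinearMap.mem_ker, linearizedMap_apply] at this
      simpa only [Polynomial.eval_monomial] using this
    have := Polynomial.card_le_degree_of_subset_roots hsub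
    rwa [Finset.card_image_of_injective _ Subtype.val_injective, Finset.card_univ] at this
  rw [Module.card_eq_pow_finrank (K := F)] at hcard
  have := (Nat.pow_le_pow_iff_right hq).mp (hcard.trans hdeg)
  omega

/-- Delsarte's and Gabidulin's construction of linear maximum rank distance codes. -/
theorem exists_isLinearMRD {F V W : Type*} [Field F] [Fintype F] [AddCommGroup V] [Module F V]
    [AddCommGroup W] [Module F W] [FiniteDimensional F V] [FiniteDimensional F W] {δ : ℕ}
    (hδ : 1 ≤ δ) (hδk : δ ≤ finrank F V) (hVW : finrank F V ≤ finrank F W) :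
    ∃ Q : Submodule F (V →ₗ[F] W), IsLinearMRD δ Q := by
  obtain ⟨p, hp⟩ := CharP.exists F
  have : Fact p.Prime := ⟨CharP.char_is_prime F p⟩
  have : NeZero (finrank F W) := ⟨by omega⟩
  let L := FiniteField.Extension F p (finrank F W)
  have hL : finrank F L = finrank F W := FiniteField.finrank_extension F p _
  let e : L ≃ₗ[F] W := LinearEquiv.ofFinrankEq _ _ hL
  obtain ⟨j, hj⟩ := (finrank_le_iff_exists_linearMap (R := F) (M := V) (M' := L)).mp
    (hVW.trans hL.ge)
  -- With dim V + 1 - δ coefficients a nonzero linearized map has kernel of dimension at most dim V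
  -- - δ, so its restriction to V along `j` keeps rank at least δ.
  let Φ : (Fin (finrank F V + 1 - δ) → L) →ₗ[F] (V →ₗ[F] W) :=
    { toFun := fun a => e.toLinearMap ∘ₗ linearizedMap F a ∘ₗ j
      map_add' := fun a b => by
        ext x
        simp [linearizedMap_apply, add_mul, Finset.sum_add_distrib]
      map_smul' := fun c a => by
        ext x
        simp [linearizedMap_apply, ← Finset.smul_sum] }
  have hrank : ∀ a, a ≠ 0 → δ ≤ finrank F (Φ a).range := by
    intro a ha
    have h1 := finrank_ker_linearizedMap_lt (F := F) ha
    have h2 := (Φ a).finrank_range_add_finrank_ker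
    have h3 : finrank F (Φ a).ker ≤ finrank F (linearizedMap F a).ker := by
      have hmem : ∀ x ∈ (Φ a).ker, j x ∈ (linearizedMap F a).ker := fun x hx => by
        have hx' : e (linearizedMap F a (j x)) = 0 := hx
        simpa using hx'
      exact LinearMap.finrank_le_finrank_of_injective (f := j.restrict hmem)
        fun x y h => Subtype.ext (hj (congrArg Subtype.val h))
    omega
  have hinj : Function.Injective Φ := by
    rw [← LinearMap.ker_eq_bot, eq_bot_iff]
    intro a ha
    by_contra hne
    have := hrank a hne
    rw [LinearMap.mem_ker.mp ha, LinearMap.range_zero, finrank_bot] at this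
    omega
  refine ⟨Φ.range, ?_, ?_⟩
  · rintro _ ⟨a, rfl⟩ h
    exact hrank a fun h0 => h (by rw [h0, map_zero])
  · rw [LinearMap.finrank_range_of_inj hinj, finrank_pi_fintype]
    simp only [Finset.sum_const, Finset.card_univ, Fintype.card_fin, smul_eq_mul, hL]
    exact mul_comm _ _

/-! ### From linear maps back to matrices. -/

section

variable {F : Type*} [Field F]

theorem rank_eq_finrank_range_toLin' {m k : ℕ} (A : Matrix (Fin m) (Fin k) F) :
    A.rank = finrank F (Matrix.toLin' A).range := rfl

variable [Fintype F]

theorem isMRD_iff_isLinearMRD {m k δ : ℕ} (hkm : k ≤ m)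
    (Q : Submodule F (Matrix (Fin m) (Fin k) F)) :
    IsMRD m k δ Q ↔ IsLinearMRD δ (Q.map (Matrix.toLin' (R := F)).toLinearMap) := by
  have hcard : Nat.card Q = Fintype.card F ^ (max m k * (min m k + 1 - δ)) ↔
      finrank F (Q.map (Matrix.toLin' (R := F)).toLinearMap) =
        finrank F (Fin m → F) * (finrank F (Fin k → F) + 1 - δ) := by
    rw [← LinearEquiv.finrank_eq (Submodule.equivMapOfInjective _ (LinearEquiv.injective _) Q),
      finrank_fin_fun, finrank_fin_fun, max_eq_left hkm, min_eq_right hkm,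
      Module.natCard_eq_pow_finrank (K := F), Nat.card_eq_fintype_card]
    exact (Nat.pow_right_injective Fintype.one_lt_card).eq_iff
  constructor
  · rintro ⟨h1, h2⟩
    refine ⟨?_, hcard.mp h2⟩
    rintro _ ⟨A, hA, rfl⟩ hne
    have := h1 A hA 0 Q.zero_mem fun h => hne (by rw [h, map_zero])
    rwa [sub_zero] at this
  · rintro ⟨h1, h2⟩
    refine ⟨fun A hA B hB hne => ?_, hcard.mpr h2⟩
    exact h1 _ ⟨A - B, Q.sub_mem hA hB, rfl⟩ fun h =>
      hne (sub_eq_zero.mp ((Matrix.toLin' (R := F)).map_eq_zero_iff.mp h))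

theorem exists_isMRD {m k δ : ℕ} (hδ : 1 ≤ δ) (hδk : δ ≤ k) (hkm : k ≤ m) :
    ∃ Q : Submodule F (Matrix (Fin m) (Fin k) F), IsMRD m k δ Q := by
  obtain ⟨Q, hQ⟩ := exists_isLinearMRD (F := F) (V := Fin k → F) (W := Fin m → F) hδ
    (by simpa using hδk) (by simpa using hkm)
  refine ⟨Q.map (LinearMap.toMatrix' (R := F)).toLinearMap,
    (isMRD_iff_isLinearMRD hkm _).mpr ?_⟩
  have hid : (Matrix.toLin' (R := F)).toLinearMap ∘ₗ (LinearMap.toMatrix' (R := F)).toLinearMap =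
      (LinearMap.id : ((Fin k → F) →ₗ[F] Fin m → F) →ₗ[F] _) :=
    LinearMap.ext fun f => Matrix.toLin'_toMatrix' f
  rwa [← Submodule.map_comp, hid, Submodule.map_id]

theorem IsMRD.rankCount_eq_delsarteCount {m k δ r : ℕ} (hδ : 1 ≤ δ) (hkm : k ≤ m) (hδr : δ ≤ r)
    (hr : r ≤ k) {Q : Submodule F (Matrix (Fin m) (Fin k) F)} (hQ : IsMRD m k δ Q) :
    (rankCount Q r : ℚ) = delsarteCount (Fintype.card F) m k δ r := by
  have := ((isMRD_iff_isLinearMRD hkm Q).mp hQ).card_rank_eq hδ hδr (by simpa using hr)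
  rw [finrank_fin_fun, finrank_fin_fun] at this
  rw [← this, rankCount, ← Nat.card_coe_set_eq]
  congr 1
  refine Nat.card_congr (Equiv.ofBijective
    (fun A => ⟨⟨Matrix.toLin' A.1, A.1, A.2.1, rfl⟩, A.2.2⟩) ⟨fun A B h => ?_, ?_⟩)
  · exact Subtype.ext ((Matrix.toLin' (R := F)).injective
      (congrArg (fun f => f.1.1) h))
  · rintro ⟨⟨_, A, hA, rfl⟩, hf⟩
    exact ⟨⟨A, hA, hf⟩, rfl⟩

end

/-! ### The linkage construction. -/

section

variable {F : Type*} [Field F]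

theorem two_mul_le_subspaceDist_iff {n k δ : ℕ} {U W : Submodule F (Fin n → F)}
    (hU : finrank F U = k) (hW : finrank F W = k) :
    2 * δ ≤ subspaceDist U W ↔ finrank F ↥(U ⊓ W) + δ ≤ k := by
  have h1 := Submodule.finrank_sup_add_finrank_inf_eq U W
  have h2 : finrank F ↥(U ⊓ W) ≤ finrank F U := Submodule.finrank_mono inf_le_left
  rw [subspaceDist]
  omega

theorem exists_injective_range_eq {V : Type*} [AddCommGroup V] [Module F V]
    [FiniteDimensional F V] {k : ℕ} (U : Submodule F V) (hU : finrank F U = k) :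
    ∃ φ : (Fin k → F) →ₗ[F] V, Function.Injective φ ∧ φ.range = U := by
  let e : (Fin k → F) ≃ₗ[F] U := LinearEquiv.ofFinrankEq _ _ (by rw [finrank_fin_fun, hU])
  refine ⟨U.subtype ∘ₗ e.toLinearMap, U.injective_subtype.comp e.injective, ?_⟩
  rw [LinearMap.range_comp_of_range_eq_top _ e.range, U.range_subtype]

section

variable {V E Y : Type*} [AddCommGroup V] [Module F V] [FiniteDimensional F V] [AddCommGroup E]
  [Module F E] [AddCommGroup Y] [Module F Y]

/-- `p` is injective on the range of `g`. Nothing is asked of `p ∘ₗ g'`, so the bound also serves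
codewords from different families. -/
theorem finrank_range_inf_range_le {g g' : V →ₗ[F] E} {p : E →ₗ[F] Y}
    (hp : Function.Injective (p ∘ₗ g)) :
    finrank F ↥(g.range ⊓ g'.range) ≤ finrank F ↥((p ∘ₗ g).range ⊓ (p ∘ₗ g').range) := by
  have hmem : ∀ z ∈ g.range ⊓ g'.range, p z ∈ (p ∘ₗ g).range ⊓ (p ∘ₗ g').range := by
    rintro _ ⟨⟨x, rfl⟩, ⟨y, hy⟩⟩
    exact ⟨⟨x, rfl⟩, ⟨y, congrArg p hy⟩⟩
  refine LinearMap.finrank_le_finrank_of_injective (f := p.restrict hmem) ?_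
  rintro ⟨_, ⟨x, rfl⟩, _⟩ ⟨_, ⟨y, rfl⟩, _⟩ h
  have hxy : x = y := hp (congrArg Subtype.val h)
  exact Subtype.ext (congrArg g hxy)

/-- If g x = g' y, applying `p` forces x = y, so the intersection is contained in the image of ker
(g - g') under g. -/
theorem finrank_range_inf_range_le_ker {g g' : V →ₗ[F] E} {p : E →ₗ[F] Y}
    (hp : Function.Injective (p ∘ₗ g)) (hpp : p ∘ₗ g = p ∘ₗ g') :
    finrank F ↥(g.range ⊓ g'.range) ≤ finrank F (g - g').ker := by
  refine (Submodule.finrank_mono ?_).trans (Submodule.finrank_map_le g (g - g').ker)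
  rintro _ ⟨⟨x, rfl⟩, ⟨y, hy⟩⟩
  have hyx : y = x := hp (by rw [LinearMap.congr_fun hpp y]; exact congrArg p hy)
  subst hyx
  exact ⟨y, by simp [hy], rfl⟩

end

theorem card_le_maxCDC [Fintype F] {n₁ n₂ k δ : ℕ} (hδ : 1 ≤ δ) {ι : Type*} [Finite ι]
    (S : ι → Submodule F ((Fin n₁ → F) × (Fin n₂ → F))) (hk : ∀ i, finrank F (S i) = k)
    (hS : ∀ i j, i ≠ j → finrank F ↥(S i ⊓ S j) + δ ≤ k) :
    Nat.card ι ≤ maxCDC F (n₁ + n₂) k (2 * δ) := by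
  classical
  have := Fintype.ofFinite ι
  let e : ((Fin n₁ → F) × (Fin n₂ → F)) ≃ₗ[F] (Fin (n₁ + n₂) → F) :=
    (LinearEquiv.sumArrowLequivProdArrow _ _ F F).symm ≪≫ₗ
      LinearEquiv.funCongrLeft F F finSumFinEquiv.symm
  have hfin : ∀ Z : Submodule F ((Fin n₁ → F) × (Fin n₂ → F)),
      finrank F (Z.map e.toLinearMap) = finrank F Z := fun Z =>
    (Submodule.equivMapOfInjective e.toLinearMap e.injective Z).finrank_eq.symm
  -- As δ ≥ 1, equal spaces would violate the intersection bound, so no codewords are lost.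
  have hinj : Function.Injective S := by
    intro i j hij
    by_contra hne
    have := hS i j hne
    rw [← hij, inf_idem, hk] at this
    omega
  refine (maxCDC_isGreatest F (n₁ + n₂) k (2 * δ)).2
    ⟨Finset.univ.image fun i => (S i).map e.toLinearMap, ⟨?_, ?_⟩, ?_⟩
  · intro U hU
    obtain ⟨i, -, rfl⟩ := Finset.mem_image.mp hU
    rw [hfin, hk]
  · intro U hU W hW hne
    obtain ⟨i, -, rfl⟩ := Finset.mem_image.mp hU
    obtain ⟨j, -, rfl⟩ := Finset.mem_image.mp hW
    rw [two_mul_le_subspaceDist_iff (by rw [hfin, hk]) (by rw [hfin, hk]),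
      ← Submodule.map_inf _ e.injective, hfin]
    exact hS i j fun h => hne (by rw [h])
  · have hinj' := (Submodule.map_injective_of_injective (f := e.toLinearMap) e.injective).comp hinj
    rw [Nat.card_eq_fintype_card]
    exact Finset.card_image_of_injective _ hinj'

theorem IsMRD.finrank_ker_sub_add_le [Fintype F] {m k δ : ℕ}
    {Q : Submodule F (Matrix (Fin m) (Fin k) F)} (hQ : IsMRD m k δ Q)
    {A B : Matrix (Fin m) (Fin k) F} (hA : A ∈ Q) (hB : B ∈ Q) (hAB : A ≠ B) :
    finrank F (Matrix.toLin' A - Matrix.toLin' B).ker + δ ≤ k := by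
  have h1 := hQ.1 A hA B hB hAB
  rw [rank_eq_finrank_range_toLin', map_sub] at h1
  have h2 := (Matrix.toLin' A - Matrix.toLin' B).finrank_range_add_finrank_ker
  rw [finrank_fin_fun] at h2
  omega

/-- The summand 1 is the zero matrix, whose rank 0 lies below δ. -/
theorem one_add_sum_rankCount_le [Fintype F] {m k δ l : ℕ} (hδ : 1 ≤ δ)
    (Q : Submodule F (Matrix (Fin m) (Fin k) F)) :
    1 + ∑ r ∈ Finset.Icc δ l, rankCount Q r ≤ Nat.card {A : Q // A.1.rank ≤ l} := by
  classical
  have h1 : ∀ r, rankCount Q r = (Finset.univ.filter fun A : Q => A.1.rank = r).card := by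
    intro r
    rw [rankCount, ← Nat.card_coe_set_eq, ← Fintype.card_subtype, ← Nat.card_eq_fintype_card]
    exact Nat.card_congr (Equiv.subtypeSubtypeEquivSubtypeInter _ _).symm
  have h0 : (0 : Q) ∉ Finset.univ.filter fun A : Q => A.1.rank ∈ Finset.Icc δ l := by
    simp
    omega
  have h2 : ∑ r ∈ Finset.Icc δ l, rankCount Q r =
      (Finset.univ.filter fun A : Q => A.1.rank ∈ Finset.Icc δ l).card := by
    rw [Finset.card_eq_sum_card_fiberwise (f := fun A : Q => A.1.rank) (t := Finset.Icc δ l)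
      fun A hA => by simpa using hA]
    refine Finset.sum_congr rfl fun r hr => ?_
    rw [h1, Finset.filter_filter]
    congr 1
    ext A
    simp only [Finset.mem_filter, Finset.mem_univ, true_and]
    exact ⟨fun h => ⟨h ▸ hr, h⟩, fun h => h.2⟩
  rw [h2, add_comm, ← Finset.card_insert_of_notMem h0, Nat.card_eq_fintype_card,
    Fintype.card_subtype]
  refine Finset.card_le_card fun A hA => ?_
  rw [Finset.mem_insert] at hA
  rcases hA with rfl | hA
  · simp
  · simp only [Finset.mem_filter, Finset.mem_univ, true_and, Finset.mem_Icc] at hA ⊢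
    exact hA.2

/-- The linkage construction, with rank restricted codewords in the second part. -/
theorem card_mul_maxCDC_add_le [Fintype F] {n₁ n₂ k δ : ℕ} (hδ : 1 ≤ δ) (hδk : δ ≤ k)
    {Q₁ : Submodule F (Matrix (Fin n₁) (Fin k) F)} {Q₂ : Submodule F (Matrix (Fin n₂) (Fin k) F)}
    (h₁ : IsMRD n₁ k δ Q₁) (h₂ : IsMRD n₂ k δ Q₂) :
    Nat.card Q₁ * maxCDC F n₂ k (2 * δ) +
        maxCDC F n₁ k (2 * δ) * (1 + ∑ r ∈ Finset.Icc δ (k - δ), rankCount Q₂ r) ≤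
      maxCDC F (n₁ + n₂) k (2 * δ) := by
  obtain ⟨⟨C₁, hC₁, hcard₁⟩, -⟩ := maxCDC_isGreatest F n₁ k (2 * δ)
  obtain ⟨⟨C₂, hC₂, hcard₂⟩, -⟩ := maxCDC_isGreatest F n₂ k (2 * δ)
  choose φ₁ hφ₁ hr₁ using fun U : C₁ => exists_injective_range_eq U.1 (hC₁.1 U.1 U.2)
  choose φ₂ hφ₂ hr₂ using fun U : C₂ => exists_injective_range_eq U.1 (hC₂.1 U.1 U.2)
  have hinf₁ : ∀ U U' : C₁, U ≠ U' → finrank F ↥((φ₁ U).range ⊓ (φ₁ U').range) + δ ≤ k := by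
    intro U U' hne
    rw [hr₁, hr₁, ← two_mul_le_subspaceDist_iff (hC₁.1 _ U.2) (hC₁.1 _ U'.2)]
    exact hC₁.2 _ U.2 _ U'.2 fun h => hne (Subtype.ext h)
  have hinf₂ : ∀ U U' : C₂, U ≠ U' → finrank F ↥((φ₂ U).range ⊓ (φ₂ U').range) + δ ≤ k := by
    intro U U' hne
    rw [hr₂, hr₂, ← two_mul_le_subspaceDist_iff (hC₂.1 _ U.2) (hC₂.1 _ U'.2)]
    exact hC₂.2 _ U.2 _ U'.2 fun h => hne (Subtype.ext h)
  let g₁ : Q₁ × C₂ → (Fin k → F) →ₗ[F] (Fin n₁ → F) × (Fin n₂ → F) := fun i =>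
    (Matrix.toLin' i.1.1).prod (φ₂ i.2)
  let g₂ : C₁ × {A : Q₂ // A.1.rank ≤ k - δ} →
      (Fin k → F) →ₗ[F] (Fin n₁ → F) × (Fin n₂ → F) := fun i =>
    (φ₁ i.1).prod (Matrix.toLin' i.2.1.1)
  have hg₁ : ∀ i, Function.Injective (LinearMap.snd F (Fin n₁ → F) (Fin n₂ → F) ∘ₗ g₁ i) :=
    fun i => hφ₂ i.2
  have hg₂ : ∀ i, Function.Injective (LinearMap.fst F (Fin n₁ → F) (Fin n₂ → F) ∘ₗ g₂ i) :=
    fun i => hφ₁ i.1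
  -- The second projection is injective on `g₁ i` and sends `g₂ j` to the range of a matrix of rank
  -- at most k - δ; this is where the rank restriction is used.
  have hcross : ∀ i j, finrank F ↥((g₁ i).range ⊓ (g₂ j).range) + δ ≤ k := by
    intro i j
    have h := finrank_range_inf_range_le (g' := g₂ j) (hg₁ i)
    have h' : finrank F ↥((LinearMap.snd F (Fin n₁ → F) (Fin n₂ → F) ∘ₗ g₁ i).range ⊓
        (LinearMap.snd F (Fin n₁ → F) (Fin n₂ → F) ∘ₗ g₂ j).range) ≤ k - δ :=
      (Submodule.finrank_mono inf_le_right).trans j.2.2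
    omega
  have key := card_le_maxCDC hδ (k := k)
    (fun i : (Q₁ × C₂) ⊕ (C₁ × {A : Q₂ // A.1.rank ≤ k - δ}) =>
      Sum.elim (fun i => (g₁ i).range) (fun i => (g₂ i).range) i) ?_ ?_
  · rw [Nat.card_sum, Nat.card_prod, Nat.card_prod, Nat.card_eq_fintype_card (α := C₁),
      Nat.card_eq_fintype_card (α := C₂), Fintype.card_coe, Fintype.card_coe, hcard₁,
      hcard₂] at key
    refine le_trans ?_ key
    gcongr
    exact one_add_sum_rankCount_le hδ Q₂
  · rintro (i | i)
    · exact (LinearMap.finrank_range_of_inj 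
        (Function.Injective.of_comp (f := LinearMap.snd F (Fin n₁ → F) (Fin n₂ → F))
          (hg₁ i))).trans
        (finrank_fin_fun F)
    · exact (LinearMap.finrank_range_of_inj 
        (Function.Injective.of_comp (f := LinearMap.fst F (Fin n₁ → F) (Fin n₂ → F))
          (hg₂ i))).trans
        (finrank_fin_fun F)
  · rintro (⟨M, U⟩ | ⟨U, M⟩) (⟨M', U'⟩ | ⟨U', M'⟩) hne
    · by_cases hU : U = U'
      · subst hU
        have hM : M.1 ≠ M'.1 := fun h => hne (by rw [Subtype.ext h])
        refine le_trans (Nat.add_le_add_right ?_ δ) (h₁.finrank_ker_sub_add_le M.2 M'.2 hM)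
        refine (finrank_range_inf_range_le_ker (g' := g₁ (M', U)) (hg₁ (M, U)) rfl).trans
          (Submodule.finrank_mono ?_)
        exact fun x hx => congrArg Prod.fst hx
      · exact le_trans (Nat.add_le_add_right (finrank_range_inf_range_le (hg₁ (M, U))) δ)
          (hinf₂ U U' hU)
    · exact hcross _ _
    · rw [inf_comm]
      exact hcross _ _
    · by_cases hU : U = U'
      · subst hU
        have hM : M.1.1 ≠ M'.1.1 := fun h => hne (by rw [Subtype.ext (Subtype.ext h)])
        refine le_trans (Nat.add_le_add_right ?_ δ)
          (h₂.finrank_ker_sub_add_le M.1.2 M'.1.2 hM)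
        refine (finrank_range_inf_range_le_ker (g' := g₂ (U, M')) (hg₂ (U, M)) rfl).trans
          (Submodule.finrank_mono ?_)
        exact fun x hx => congrArg Prod.snd hx
      · exact le_trans (Nat.add_le_add_right (finrank_range_inf_range_le (hg₂ (U, M))) δ)
          (hinf₁ U U' hU)

end

end CDC

theorem corollary1 {F : Type*} [Field F] [Fintype F] (n₁ n₂ k d : ℕ)
    (hd : Even d) (hd0 : 0 < d) (hkd : d ≤ k) (hn₁ : k ≤ n₁) (hn₂ : k ≤ n₂) :
    -- the codes `Q_q(n₁, k, d/2)` and `Q_q(n₂, k, d/2)` exist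
    (∃ Q₁ : Submodule F (Matrix (Fin n₁) (Fin k) F), CDC.IsMRD n₁ k (d / 2) Q₁) ∧
    (∃ Q₂ : Submodule F (Matrix (Fin n₂) (Fin k) F), CDC.IsMRD n₂ k (d / 2) Q₂) ∧
    -- the bound, for whatever such codes are taken
    (∀ (Q₁ : Submodule F (Matrix (Fin n₁) (Fin k) F))
        (Q₂ : Submodule F (Matrix (Fin n₂) (Fin k) F)),
      CDC.IsMRD n₁ k (d / 2) Q₁ → CDC.IsMRD n₂ k (d / 2) Q₂ →
        Nat.card ↥Q₁ * CDC.maxCDC F n₂ k d +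
            CDC.maxCDC F n₁ k d *
              (1 + ∑ r ∈ Finset.Icc (d / 2) (k - d / 2), CDC.rankCount Q₂ r) ≤
          CDC.maxCDC F (n₁ + n₂) k d) ∧
    -- the bound with the sizes and Delsarte's rank distribution put in
    (Fintype.card F : ℚ) ^ (n₁ * (k - d / 2 + 1)) * (CDC.maxCDC F n₂ k d : ℚ) +
        (CDC.maxCDC F n₁ k d : ℚ) *
          (1 + ∑ r ∈ Finset.Icc (d / 2) (k - d / 2),
            CDC.delsarteCount (Fintype.card F) n₂ k (d / 2) r) ≤
      (CDC.maxCDC F (n₁ + n₂) k d : ℚ) := by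
  obtain ⟨δ, rfl⟩ := even_iff_exists_two_mul.mp hd
  rw [Nat.mul_div_cancel_left δ two_pos]
  have hδ : 1 ≤ δ := by omega
  obtain ⟨Q₁, h₁⟩ := CDC.exists_isMRD (F := F) hδ (by omega : δ ≤ k) hn₁
  obtain ⟨Q₂, h₂⟩ := CDC.exists_isMRD (F := F) hδ (by omega : δ ≤ k) hn₂
  refine ⟨⟨Q₁, h₁⟩, ⟨Q₂, h₂⟩,
    fun Q₁ Q₂ h₁ h₂ => CDC.card_mul_maxCDC_add_le hδ (by omega) h₁ h₂, ?_⟩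
  have h := CDC.card_mul_maxCDC_add_le hδ (by omega) h₁ h₂
  rw [h₁.2, max_eq_left hn₁, min_eq_right hn₁, show k + 1 - δ = k - δ + 1 by omega] at h
  have hsum : ∑ r ∈ Finset.Icc δ (k - δ), CDC.delsarteCount (Fintype.card F) n₂ k δ r =
      ∑ r ∈ Finset.Icc δ (k - δ), (CDC.rankCount Q₂ r : ℚ) := by
    refine Finset.sum_congr rfl fun r hr => ?_
    rw [Finset.mem_Icc] at hr
    exact (h₂.rankCount_eq_delsarteCount hδ hn₂ hr.1 (by omega)).symm
  rw [hsum]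
  exact_mod_cast h
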